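/- **Setting.** Let $k$ be an index set; $\mathbb N_0^k$ and $\mathbb Z^k$ denote the finitely supported functions on $k$. A *$k$-semigraph algebra* is a complex $*$-algebra $X$ generated by disjoint subsets $\mathcal P,\mathcal T\subseteq X$ together with a map $d:\mathcal T\to\mathbb N_0^k$ such that, with $\mathcal T_1=\mathcal T\sqcup\{1\}$ ($1$ being the unit of the unitization of $X$), $d(1)=0$, and a product in $\mathcal T_1$ being regarded as defined exactly if it is nonzero: (i) $\mathcal P$ is a set of commuting projections closed under multiplication; (ii) $\mathcal T$ is a set of nonzero partial isometries closed under nonzero products; (iii) $\mathcal T_1$ is a finitely aligned $k$-semigraph: $d(xy)=d(x)+d(y)$ whenever $xy$ is defined; if $d(x)=m+n$ there are unique $x_1,x_2\in\mathcal T_1$ with $x=x_1x_2$, $d(x_1)=m$, $d(x_2)=n$; and for all $x,y\in\mathcal T_1$ the set $\mathcal T_1^{(\min)}(x,y)$ of pairs $(\alpha,\beta)\in\mathcal T_1\times\mathcal T_1$ such that $x\alpha$, $y\beta$ are defined, $x\alpha=y\beta$ and $d(x\alpha)=d(x)\vee d(y)$ is finite; (iv) for all $x\in\mathcal T$, $p\in\mathcal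 P$ there is $q\in\mathcal P$ with $px=xq$; (v) for all $x,y\in\mathcal T$ there are $q_{x,y,\alpha,\beta}\in\mathcal P$ with $x^*y=\sum_{(\alpha,\beta)\in\mathcal T_1^{(\min)}(x,y)}\alpha\, q_{x,y,\alpha,\beta}\,\beta^*$; (vi) let $\mathbb F$ be the free non-unital $*$-algebra on $\mathcal P\sqcup\mathcal T$, and let the degree $d(w)\in\mathbb Z^k$ of a word $w$ be the sum of the degrees of its letters, where $d(p)=d(p^*)=0$ for $p\in\mathcal P$ and $d(t^*)=-d(t)$ for $t\in\mathcal T$; then the kernel of the canonical map $\mathbb F\to X$ is generated, as a self-adjoint two-sided ideal, by a set of elements each of which is a linear combination of words of one common degree. The *core* of $X$ is the linear span in $X$ of the words of degree $0$. For $Z\subseteq X$ let $$\mathbb P(Z)=\{P_x(1-P_{y_1})\cdots(1-P_{y_m}) : m\ge 0,\ x,y_1,\dots,y_m\in Z\},\qquad P_x=xx^*.$$ The elements of $\mathbb P(\mathcal T_1\mathcal P)$, where $\mathcal T_1\mathcal P=\{sp: s\in\mathcal T_1,\,p\in\mathcal P\}$, are the *standard projections*, those of $\mathbb P(\mathcal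 P)$ the *elementary standard projections*. An *increasing sequence* in $\mathcal T_1$ is a map $x:\mathbb N_0^k\to\mathcal T_1$ with $d(x_n)=n$ such that $x_m$ is the initial segment of $x_n$ of degree $m$ whenever $m\le n$. Let $\mathcal O$ be the set of standard projections $p$ such that for every increasing sequence $x$ one has $p\,x_n=0$ eventually. $X$ is *full* if it coincides with its quotient by the self-adjoint two-sided ideal generated by $\mathcal O$, i.e. if this ideal is zero. **Lemma.** Let $X$ be a full $k$-semigraph algebra and let $\pi:X\to B$ be a representation of $X$, i.e. a $*$-homomorphism into a $C^*$-algebra $B$. Then $\pi$ is injective on the core of $X$ if and only if $\pi(e)\neq 0$ for every nonzero elementary standard projection $e\in\mathbb P(\mathcal P)$. -/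

import Mathlib

noncomputable section

/-- The self-adjoint two-sided ideal `⟨Y⟩` generated by a subset `Y` of an algebra `A` over `ℂ` with
involution `inv`: the smallest linear subspace that contains `Y` and is closed under
multiplication by elements of `A` from both sides and under the involution. -/
def starIdealSpan {A : Type*} [NonUnitalRing A] [Module ℂ A] (inv : A → A) (Y : Set A) :
    Submodule ℂ A :=
  sInf {I : Submodule ℂ A | Y ⊆ I ∧
    (∀ a x, x ∈ I → a * x ∈ I) ∧ (∀ a x, x ∈ I → x * a ∈ I) ∧ ∀ x ∈ I, inv x ∈ I}

/-- The set `ℙ(Z)` of all elements `P_x (1 - P_{y₁}) ⋯ (1 - P_{yₘ})` of `X`, where `m ≥ 0`,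
`x, y₁, …, yₘ ∈ Z` and `P_x = x x*`. The unit `1` is the one of the unitization of `X`. -/
def projectionSet {X : Type*} [NonUnitalRing X] [StarRing X] [Module ℂ X] [IsScalarTower ℂ X X]
    [SMulCommClass ℂ X X] (Z : Set X) : Set X :=
  {e | ∃ x ∈ Z, ∃ l : List X, (∀ y ∈ l, y ∈ Z) ∧
    (Unitization.inr e : Unitization ℂ X) =
      Unitization.inr (x * star x) *
        (l.map fun y => (1 - Unitization.inr (y * star y) : Unitization ℂ X)).prod}

/-- Two subsets `P` and `T` of `X` and a degree map `d : T → ℕ₀^k`; here `ℕ₀^k` is the set of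
finitely supported functions from the index set `k` to `ℕ₀`. -/
structure SemigraphData (k X : Type*) where
  /-- the projections -/
  P : Set X
  /-- the partial isometries -/
  T : Set X
  /-- the degree map of `T` -/
  deg : T → (k →₀ ℕ)

namespace SemigraphData

section Words

variable {k X : Type*} (G : SemigraphData k X)

/-- `T₁ = T ⊔ {1}`; the additional unit `1` is `none`. -/
abbrev T₁ : Type _ := Option G.T

/-- The degree map of `T₁`, with `d(1) = 0`. -/
def deg₁ : G.T₁ → (k →₀ ℕ)
  | none => 0
  | some t => G.deg t

/-- The letters `a` and `a*` with `a ∈ P ⊔ T`; the flag `true` marks `a*`. -/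
abbrev Letter : Type _ := (G.P ⊕ G.T) × Bool

/-- The non-empty formal words in the letters `a` and `a*`, `a ∈ P ⊔ T`. -/
abbrev Word : Type _ := FreeSemigroup G.Letter

/-- The free non-unital `*`-algebra `𝔽` on `P ⊔ T`: the complex vector space with basis the
non-empty words, multiplied by concatenation. -/
abbrev Free : Type _ := MonoidAlgebra ℂ G.Word

/-- The formal adjoint of a word. -/
def wordStar (w : G.Word) : G.Word :=
  (FreeSemigroup.lift (fun l : G.Letter => MulOpposite.op (FreeSemigroup.of (l.1, !l.2))) w).unop

/-- The involution of `𝔽`: the conjugate linear extension of the formal adjoint of words. -/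
def freeStar (f : G.Free) : G.Free :=
  f.coeff.sum fun w c => MonoidAlgebra.single (G.wordStar w) (star c)

/-- The degree of a letter: `d(p) = d(p*) = 0`, `d(t)` is the semigraph degree and
`d(t*) = -d(t)`. -/
def letterDegree : G.Letter → (k →₀ ℤ)
  | (Sum.inl _, _) => 0
  | (Sum.inr t, false) => (G.deg t).mapRange (fun n : ℕ => (n : ℤ)) rfl
  | (Sum.inr t, true) => -(G.deg t).mapRange (fun n : ℕ => (n : ℤ)) rfl

/-- The degree of a word is the sum of the degrees of its letters. -/
def wordDegree (w : G.Word) : k →₀ ℤ :=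
  (FreeSemigroup.lift (fun l : G.Letter => Multiplicative.ofAdd (G.letterDegree l)) w).toAdd

/-- The fiber space of `𝔽`: the union over all `n ∈ ℤ^k` of the linear spans of the words of
degree `n`. -/
def fiberSpace : Set G.Free :=
  {f | ∃ n : k →₀ ℤ,
    f ∈ Submodule.span ℂ
      ((fun w : G.Word => (MonoidAlgebra.single w 1 : G.Free)) '' {w | G.wordDegree w = n})}

end Words

section Algebra

variable {k X : Type*} [NonUnitalRing X] [StarRing X] [Module ℂ X] [IsScalarTower ℂ X X]
  [SMulCommClass ℂ X X] [StarModule ℂ X] (G : SemigraphData k X)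

/-- The inclusion of `T₁` in the unitization of `X`. -/
def ι : G.T₁ → Unitization ℂ X
  | none => 1
  | some t => Unitization.inr (t : X)

/-- The product `x y` is defined in `T₁` and equal to `z`. The product of two elements of `T` is
defined in `T` exactly if it lies in `T`. -/
def IsProd (x y z : G.T₁) : Prop := G.ι x * G.ι y = G.ι z

/-- The minimal common extensions `T₁^(min)(x, y)`: the pairs `(α, β)` for which `x α` and `y β`
are defined, `x α = y β` and `d(x α) = d(x) ∨ d(y)`. -/
def minExt (x y : G.T₁) : Set (G.T₁ × G.T₁) :=
  {ab | ∃ z, G.IsProd x ab.1 z ∧ G.IsProd y ab.2 z ∧ G.deg₁ z = G.deg₁ x ⊔ G.deg₁ y}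

/-- The element of `X` that a letter stands for. -/
def evalLetter : G.Letter → X
  | (Sum.inl p, false) => p
  | (Sum.inl p, true) => star (p : X)
  | (Sum.inr t, false) => t
  | (Sum.inr t, true) => star (t : X)

/-- The element of `X` that a word stands for. -/
def evalWord : G.Word →ₙ* X := FreeSemigroup.lift G.evalLetter

/-- The canonical homomorphism `𝔽 → X`. -/
def evalFree : G.Free →ₙₐ[ℂ] X := MonoidAlgebra.liftMagma ℂ G.evalWord

/-- `X` is a `k`-semigraph algebra with generating sets `P` and `T` and degree map `d`. -/
structure IsSemigraphAlgebra : Prop where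
  disjoint : Disjoint G.P G.T
  generates : NonUnitalStarAlgebra.adjoin ℂ (G.P ∪ G.T) = ⊤
  -- `P` is a set of commuting projections closed under multiplication
  proj : ∀ p ∈ G.P, IsStarProjection p
  proj_comm : ∀ p ∈ G.P, ∀ q ∈ G.P, p * q = q * p
  proj_mul : ∀ p ∈ G.P, ∀ q ∈ G.P, p * q ∈ G.P
  -- `T` is a set of nonzero partial isometries closed under nonzero products
  ne_zero : ∀ t ∈ G.T, t ≠ 0
  partialIsometry : ∀ t ∈ G.T, t * star t * t = t
  mul_mem : ∀ s ∈ G.T, ∀ t ∈ G.T, s * t ≠ 0 → s * t ∈ G.T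
  -- `T` is a non-unital finitely aligned `k`-semigraph, that is, `T₁` is a finitely aligned
  -- `k`-semigraph (associativity is inherited from `X`)
  deg_mul : ∀ x y z : G.T₁, G.IsProd x y z → G.deg₁ z = G.deg₁ x + G.deg₁ y
  factorization : ∀ (x : G.T₁) (m n : k →₀ ℕ), G.deg₁ x = m + n →
    ∃! yz : G.T₁ × G.T₁, G.IsProd yz.1 yz.2 x ∧ G.deg₁ yz.1 = m ∧ G.deg₁ yz.2 = n
  finitelyAligned : ∀ x y : G.T₁, (G.minExt x y).Finite
  -- projections can be moved past elements of `T`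
  proj_skip : ∀ x ∈ G.T, ∀ p ∈ G.P, ∃ q ∈ G.P, p * x = x * q
  -- the expansion of `x* y`, an identity in the unitization of `X`
  expansion : ∀ x y : G.T, ∃ q : G.T₁ × G.T₁ → X,
    (∀ ab ∈ G.minExt (some x) (some y), q ab ∈ G.P) ∧
    (Unitization.inr (star (x : X) * (y : X)) : Unitization ℂ X) =
      ∑ ab ∈ (finitelyAligned (some x) (some y)).toFinset,
        G.ι ab.1 * Unitization.inr (q ab) * star (G.ι ab.2)
  -- `X` is canonically the quotient of `𝔽` by a subset of the fiber space
  homogeneous : ∃ Y ⊆ G.fiberSpace,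
    ∀ f : G.Free, G.evalFree f = 0 ↔ f ∈ starIdealSpan G.freeStar Y

/-- The core `X₀`: the linear span of all words of degree zero. -/
def core : Submodule ℂ X := Submodule.span ℂ (G.evalWord '' {w | G.wordDegree w = 0})

/-- The half-standard words, that is, the elements of `T₁ P`. -/
def halfStandardWords : Set X :=
  {a | ∃ s : G.T₁, ∃ p ∈ G.P, (Unitization.inr a : Unitization ℂ X) = G.ι s * Unitization.inr p}

/-- The standard projections, that is, the elements of `ℙ(T₁ P)`. -/
def standardProjections : Set X := projectionSet G.halfStandardWords

/-- The elementary standard projections, that is, the elements of `ℙ(P)`. -/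
def elementaryStandardProjections : Set X := projectionSet G.P

/-- The increasing sequences in `T₁`: maps `x : ℕ₀^k → T₁` such that `d(x_n) = n` for all `n` and
`x_m` is the initial segment of `x_n` of degree `m` whenever `m ≤ n`. -/
def IsIncreasing (x : (k →₀ ℕ) → G.T₁) : Prop :=
  (∀ n, G.deg₁ (x n) = n) ∧ ∀ m n, m ≤ n → ∃ y, G.IsProd (x m) y (x n)

/-- The set `𝒪` of all standard projections `p` such that for every increasing sequence `x` in
`T₁` one has `p x_n = 0` eventually. -/
def vanishing : Set X :=
  {p | p ∈ G.standardProjections ∧ ∀ x, G.IsIncreasing x →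
    ∀ᶠ n in Filter.atTop, (Unitization.inr p : Unitization ℂ X) * G.ι (x n) = 0}

/-- The semigraph algebra `X` is full, that is, it coincides with its quotient by the ideal
generated by `𝒪`: this ideal is zero. -/
def IsFull : Prop := starIdealSpan (star : X → X) G.vanishing = ⊥

end Algebra

end SemigraphData

end

/-! Elementary standard projections lie in the linear span of `P`, hence in the core, which gives
one direction. For the other, the two-sided ideal generated by a nonzero core element `x` is shown
to contain a nonzero elementary standard projection; if `π x = 0`, then `π` kills this projection.

All computations take place in the unitization. By the expansion of `x* y`, the core is contained in
the span of words `a p b*` with `d(a) = d(b)`. Some range projection `E = s p s*` satisfies `E x ≠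
0`. It is refined to a standard projection `g` at some `z`, with `g x ≠ 0`, such that for each word
`a p b*` of `x` either `g` is orthogonal to `a p a*` or `z` extends `a`. Then `g x` is a single row
of elements `g z q t*` with `d(t) = d(z)` (`exists_refines_rowSpan`). Different `t` of equal degree
have orthogonal ranges, so one `t` gives `0 ≠ g x t z* = g D` with `D` in the span of the range
projections. A further refinement `f` makes `D` a nonzero scalar, so `f = c⁻¹ f x t z*`
(`exists_stdAt_eq_mul`).

Fullness keeps `f ≠ 0` out of `𝒪`, so `f y ≠ 0` for some `y` of degree so large that every range
projection occurring in `f` either vanishes on `y` or moves past it as an element of `P`. Then `y* f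
y` is the required projection (`exists_elementary`). -/

namespace SemigraphData

variable {k X : Type*} [NonUnitalRing X] [StarRing X] [Module ℂ X] [IsScalarTower ℂ X X]
  [SMulCommClass ℂ X X] [StarModule ℂ X] {G : SemigraphData k X}

set_option linter.unusedSectionVars false

/-! ### Relations in the unitization -/

/-- The projections of `P`, regarded in the unitization of `X`. -/
def projSet (G : SemigraphData k X) : Set (Unitization ℂ X) :=
  {u | ∃ p ∈ G.P, Unitization.inr p = u}

/-- The projections of `P` together with the unit. -/
def projSet₁ (G : SemigraphData k X) : Set (Unitization ℂ X) := insert 1 G.projSet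

theorem projSet_subset : G.projSet ⊆ G.projSet₁ := Set.subset_insert _ _

theorem one_mem_projSet₁ : (1 : Unitization ℂ X) ∈ G.projSet₁ := Set.mem_insert _ _

theorem isProd_one_left (x : G.T₁) : G.IsProd none x x := one_mul _

theorem isProd_one_right (x : G.T₁) : G.IsProd x none x := mul_one _

namespace IsSemigraphAlgebra

theorem star_eq (hG : G.IsSemigraphAlgebra)
    {p : Unitization ℂ X} (hp : p ∈ G.projSet₁) : star p = p := by
  rcases hp with rfl | ⟨p, hp, rfl⟩
  · exact star_one _
  · rw [← Unitization.inr_star, (hG.proj p hp).isSelfAdjoint.star_eq]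

theorem mul_self (hG : G.IsSemigraphAlgebra)
    {p : Unitization ℂ X} (hp : p ∈ G.projSet₁) : p * p = p := by
  rcases hp with rfl | ⟨p, hp, rfl⟩
  · exact one_mul _
  · rw [← Unitization.inr_mul, (hG.proj p hp).isIdempotentElem.eq]

theorem comm (hG : G.IsSemigraphAlgebra)
    {p q : Unitization ℂ X} (hp : p ∈ G.projSet₁) (hq : q ∈ G.projSet₁) :
    p * q = q * p := by
  rcases hp with rfl | ⟨p, hp, rfl⟩
  · rw [one_mul, mul_one]
  rcases hq with rfl | ⟨q, hq, rfl⟩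
  · rw [one_mul, mul_one]
  rw [← Unitization.inr_mul, hG.proj_comm p hp q hq, Unitization.inr_mul]

theorem mul_mem_left (hG : G.IsSemigraphAlgebra)
    {p q : Unitization ℂ X} (hp : p ∈ G.projSet) (hq : q ∈ G.projSet₁) :
    p * q ∈ G.projSet := by
  rcases hq with rfl | ⟨q, hq, rfl⟩
  · rwa [mul_one]
  obtain ⟨p, hp, rfl⟩ := hp
  exact ⟨p * q, hG.proj_mul p hp q hq, Unitization.inr_mul _ _ _⟩

theorem mul_mem_right (hG : G.IsSemigraphAlgebra)
    {p q : Unitization ℂ X} (hp : p ∈ G.projSet₁) (hq : q ∈ G.projSet) :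
    p * q ∈ G.projSet := by
  rw [hG.comm hp (projSet_subset hq)]
  exact hG.mul_mem_left hq hp

theorem mul_mem₁ (hG : G.IsSemigraphAlgebra)
    {p q : Unitization ℂ X} (hp : p ∈ G.projSet₁) (hq : q ∈ G.projSet₁) :
    p * q ∈ G.projSet₁ := by
  rcases hp with rfl | hp
  · rwa [one_mul]
  · exact projSet_subset (hG.mul_mem_left hp hq)

theorem exists_skip (hG : G.IsSemigraphAlgebra)
    {p : Unitization ℂ X} (hp : p ∈ G.projSet) (s : G.T₁) :
    ∃ q ∈ G.projSet, p * G.ι s = G.ι s * q := by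
  cases s with
  | none => exact ⟨p, hp, by simp [ι]⟩
  | some t =>
    obtain ⟨p, hp, rfl⟩ := hp
    obtain ⟨q, hq, h⟩ := hG.proj_skip t t.2 p hp
    exact ⟨_, ⟨q, hq, rfl⟩, by simp only [ι, ← Unitization.inr_mul, h]⟩

/-- The adjoint of a relation `p s = s q`. -/
theorem star_skip (hG : G.IsSemigraphAlgebra)
    {p q : Unitization ℂ X} (hp : p ∈ G.projSet₁) (hq : q ∈ G.projSet₁)
    {s : G.T₁} (h : p * G.ι s = G.ι s * q) : star (G.ι s) * p = q * star (G.ι s) := by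
  have := congrArg star h
  rwa [star_mul, star_mul, hG.star_eq hp, hG.star_eq hq] at this

theorem ι_injective : Function.Injective G.ι := by
  have key : ∀ t : G.T, (1 : Unitization ℂ X) ≠ Unitization.inr (t : X) := fun t h => by
    simpa using congrArg (Unitization.fstHom ℂ X) h
  intro x y h
  rcases x with _ | x <;> rcases y with _ | y
  · rfl
  · exact (key y h).elim
  · exact (key x h.symm).elim
  · exact congrArg some (Subtype.ext (Unitization.inr_injective h))

theorem ι_ne_zero (hG : G.IsSemigraphAlgebra) (x : G.T₁) : G.ι x ≠ 0 := by
  rcases x with _ | x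
  · exact one_ne_zero
  · intro h
    exact hG.ne_zero x x.2 (Unitization.inr_injective (R := ℂ) (by simpa [ι] using h))

/-- The factorizations `1 x` and `x 1` both have degrees `0 + 0`, so uniqueness identifies them. -/
theorem eq_none_of_deg₁_eq_zero (hG : G.IsSemigraphAlgebra)
    {x : G.T₁} (h : G.deg₁ x = 0) : x = none := by
  obtain ⟨yz, -, hu⟩ := hG.factorization x 0 0 (by simpa using h)
  have h₁ := hu (none, x) ⟨isProd_one_left x, rfl, h⟩
  have h₂ := hu (x, none) ⟨isProd_one_right x, h, rfl⟩
  exact (Prod.ext_iff.1 (h₂.trans h₁.symm)).1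

theorem ι_mul_eq_zero_or (hG : G.IsSemigraphAlgebra)
    (x y : G.T₁) : G.ι x * G.ι y = 0 ∨ ∃ z, G.IsProd x y z := by
  rcases x with _ | x
  · exact .inr ⟨y, isProd_one_left y⟩
  rcases y with _ | y
  · exact .inr ⟨some x, isProd_one_right _⟩
  by_cases h : (x : X) * y = 0
  · exact .inl (by simp only [ι, ← Unitization.inr_mul, h, Unitization.inr_zero])
  · exact .inr ⟨some ⟨_, hG.mul_mem x x.2 y y.2 h⟩, by
      simp only [IsProd, ι, ← Unitization.inr_mul]⟩

theorem eq_of_isProd_of_deg₁_eq (hG : G.IsSemigraphAlgebra)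
    {x y z : G.T₁} (h : G.IsProd x y z) (hd : G.deg₁ z = G.deg₁ x) :
    y = none ∧ z = x := by
  have h₀ : y = none := hG.eq_none_of_deg₁_eq_zero (by
    have := hG.deg_mul x y z h
    rwa [hd, left_eq_add] at this)
  subst h₀
  exact ⟨rfl, ι_injective (h.symm.trans (mul_one _))⟩

theorem ι_mul_star_mul (hG : G.IsSemigraphAlgebra)
    (s : G.T₁) : G.ι s * star (G.ι s) * G.ι s = G.ι s := by
  rcases s with _ | t
  · simp [ι]
  · simp only [ι, ← Unitization.inr_star, ← Unitization.inr_mul, hG.partialIsometry t t.2]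

theorem star_mul_ι_mul_star (hG : G.IsSemigraphAlgebra)
    (s : G.T₁) : star (G.ι s) * G.ι s * star (G.ι s) = star (G.ι s) := by
  have := congrArg star (hG.ι_mul_star_mul s)
  simpa [mul_assoc] using this

/-- The product `x* y` is a sum of elements `α q β*` with `(α, β)` a minimal common extension. -/
theorem star_ι_mul_ι_mem (hG : G.IsSemigraphAlgebra)
    (x y : G.T₁) : star (G.ι x) * G.ι y ∈ AddSubmonoid.closure
    {g | ∃ a b z q, G.IsProd x a z ∧ G.IsProd y b z ∧ G.deg₁ z = G.deg₁ x ⊔ G.deg₁ y ∧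
      q ∈ G.projSet₁ ∧ g = G.ι a * q * star (G.ι b)} := by
  rcases x with _ | x
  · exact AddSubmonoid.subset_closure ⟨y, none, y, 1, isProd_one_left _, isProd_one_right _,
      by simp [deg₁], one_mem_projSet₁, by simp [ι]⟩
  rcases y with _ | y
  · exact AddSubmonoid.subset_closure ⟨none, some x, some x, 1, isProd_one_right _,
      isProd_one_left _, by simp [deg₁], one_mem_projSet₁, by simp [ι]⟩
  obtain ⟨q, hq, h⟩ := hG.expansion x y
  have h' : star (G.ι (some x)) * G.ι (some y) =
      Unitization.inr (star (x : X) * (y : X)) := by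
    simp only [ι, Unitization.inr_mul, Unitization.inr_star]
  rw [h', h]
  refine AddSubmonoid.sum_mem _ fun ab hab => AddSubmonoid.subset_closure ?_
  have hab' := (Set.Finite.mem_toFinset _).1 hab
  obtain ⟨z, h₁, h₂, h₃⟩ := id hab'
  exact ⟨ab.1, ab.2, z, _, h₁, h₂, h₃, projSet_subset ⟨_, hq ab hab', rfl⟩, rfl⟩

/-- A minimal common extension would have the same degree as `x` and `y`, hence equal both. For `x ≠
y` there is none, and the expansion of `x* y` is empty. -/
theorem star_ι_mul_ι_eq_zero (hG : G.IsSemigraphAlgebra)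
    {x y : G.T₁} (hd : G.deg₁ x = G.deg₁ y) (hne : x ≠ y) :
    star (G.ι x) * G.ι y = 0 := by
  have h := hG.star_ι_mul_ι_mem x y
  generalize star (G.ι x) * G.ι y = w at h
  induction h using AddSubmonoid.closure_induction with
  | zero => rfl
  | add a b _ _ ha hb => rw [ha, hb, add_zero]
  | mem g hg =>
    obtain ⟨a, b, z, q, h₁, h₂, h₃, -⟩ := hg
    have hx := (hG.eq_of_isProd_of_deg₁_eq h₁ (by simp [h₃, hd])).2
    have hy := (hG.eq_of_isProd_of_deg₁_eq h₂ (by simp [h₃, hd])).2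
    exact absurd (hx.symm.trans hy) hne

/-- The only minimal common extension of `t` with itself is `(1, 1)`, so the expansion of `t* t` is
a single element of `P`. -/
theorem star_ι_mul_ι_self_mem (hG : G.IsSemigraphAlgebra) (t : G.T) :
    star (G.ι (some t)) * G.ι (some t) ∈ G.projSet := by
  obtain ⟨q, hq, h⟩ := hG.expansion t t
  have h' : star (G.ι (some t)) * G.ι (some t) = Unitization.inr (star (t : X) * (t : X)) := by
    simp only [ι, Unitization.inr_mul, Unitization.inr_star]
  have hmem : ((none, none) : G.T₁ × G.T₁) ∈ G.minExt (some t) (some t) :=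
    ⟨some t, isProd_one_right _, isProd_one_right _, by simp⟩
  have hs : (hG.finitelyAligned (some t) (some t)).toFinset = {(none, none)} := by
    ext ⟨a, b⟩
    rw [Set.Finite.mem_toFinset, Finset.mem_singleton]
    refine ⟨?_, fun h => h ▸ hmem⟩
    rintro ⟨z, h₁, h₂, h₃⟩
    exact Prod.ext (hG.eq_of_isProd_of_deg₁_eq h₁ (by simp [h₃])).1
      (hG.eq_of_isProd_of_deg₁_eq h₂ (by simp [h₃])).1
  rw [h', h, hs, Finset.sum_singleton]
  exact ⟨q (none, none), hq _ hmem, by simp [ι]⟩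

theorem star_ι_mul_ι_self_mem₁ (hG : G.IsSemigraphAlgebra)
    (s : G.T₁) : star (G.ι s) * G.ι s ∈ G.projSet₁ := by
  rcases s with _ | t
  · simpa [ι] using one_mem_projSet₁ (G := G)
  · exact projSet_subset (hG.star_ι_mul_ι_self_mem t)

end IsSemigraphAlgebra

/-! ### Range projections and refinement of standard projections -/

/-- The range projections `s p s*` of the half-standard words. -/
def diagProj (G : SemigraphData k X) : Set (Unitization ℂ X) :=
  {E | ∃ s, ∃ p ∈ G.projSet, E = G.ι s * p * star (G.ι s)}

/-- The standard projections `s p s* (1 - E₁) ⋯ (1 - Eₘ)` whose first factor belongs to `s`. -/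
def stdAt (G : SemigraphData k X) (s : G.T₁) : Set (Unitization ℂ X) :=
  {f | ∃ p ∈ G.projSet, ∃ l : List (Unitization ℂ X), (∀ E ∈ l, E ∈ G.diagProj) ∧
    f = G.ι s * p * star (G.ι s) * (l.map (1 - ·)).prod}

/-- The projection `g`, standard at `z`, lies below `f`, and `z` extends `s`. -/
def Refines (G : SemigraphData k X) (z : G.T₁) (g : Unitization ℂ X) (s : G.T₁)
    (f : Unitization ℂ X) : Prop :=
  g ∈ G.stdAt z ∧ g * f = g ∧ ∃ u, G.IsProd s u z

namespace IsSemigraphAlgebra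

/-- The source projection `s* s` commutes with `p` and is absorbed by `s`; then `p` moves past `a`.
-/
theorem diag_mul_ι (hG : G.IsSemigraphAlgebra)
    {s a z : G.T₁} {p p' : Unitization ℂ X} (hp : p ∈ G.projSet)
    (hz : G.IsProd s a z) (h : p * G.ι a = G.ι a * p') :
    G.ι s * p * star (G.ι s) * G.ι z = G.ι z * p' := by
  have hc := hG.comm (projSet_subset hp) (hG.star_ι_mul_ι_self_mem₁ s)
  calc G.ι s * p * star (G.ι s) * G.ι z
      = G.ι s * (p * (star (G.ι s) * G.ι s)) * G.ι a := by rw [← hz]; simp only [mul_assoc]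
    _ = G.ι s * star (G.ι s) * G.ι s * (p * G.ι a) := by rw [hc]; simp only [mul_assoc]
    _ = G.ι z * p' := by rw [hG.ι_mul_star_mul, h, ← hz, mul_assoc]

theorem star_diag (hG : G.IsSemigraphAlgebra)
    {s : G.T₁} {p : Unitization ℂ X} (hp : p ∈ G.projSet) :
    star (G.ι s * p * star (G.ι s)) = G.ι s * p * star (G.ι s) := by
  simp only [star_mul, star_star, hG.star_eq (projSet_subset hp), mul_assoc]

theorem star_ι_mul_diag (hG : G.IsSemigraphAlgebra)
    {s a z : G.T₁} {p p' : Unitization ℂ X} (hp : p ∈ G.projSet)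
    (hp' : p' ∈ G.projSet₁) (hz : G.IsProd s a z) (h : p * G.ι a = G.ι a * p') :
    star (G.ι z) * (G.ι s * p * star (G.ι s)) = p' * star (G.ι z) := by
  have := congrArg star (hG.diag_mul_ι hp hz h)
  rwa [star_mul, hG.star_diag hp, star_mul, hG.star_eq hp'] at this

/-- A product of two range projections is a sum of range projections below both factors. -/
theorem diag_mul_diag_mem (hG : G.IsSemigraphAlgebra)
    {s t : G.T₁} {p q : Unitization ℂ X} (hp : p ∈ G.projSet)
    (hq : q ∈ G.projSet) :
    G.ι s * p * star (G.ι s) * (G.ι t * q * star (G.ι t)) ∈ AddSubmonoid.closure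
      {g | ∃ z u v, ∃ r ∈ G.projSet, G.IsProd s u z ∧ G.IsProd t v z ∧
        g = G.ι z * r * star (G.ι z) ∧ g * (G.ι s * p * star (G.ι s)) = g ∧
        g * (G.ι t * q * star (G.ι t)) = g} := by
  have h := hG.star_ι_mul_ι_mem s t
  have e : G.ι s * p * star (G.ι s) * (G.ι t * q * star (G.ι t)) =
      G.ι s * p * (star (G.ι s) * G.ι t) * (q * star (G.ι t)) := by simp only [mul_assoc]
  rw [e]
  generalize star (G.ι s) * G.ι t = w at h
  induction h using AddSubmonoid.closure_induction with
  | zero => simp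
  | add a b _ _ ha hb => rw [mul_add, add_mul]; exact add_mem ha hb
  | mem g hg =>
    obtain ⟨a, b, z, r, h₁, h₂, -, hr, rfl⟩ := hg
    obtain ⟨p', hp', hpa⟩ := hG.exists_skip hp a
    obtain ⟨q', hq', hqb⟩ := hG.exists_skip hq b
    have hp₁ := projSet_subset hp'
    have hq₁ := projSet_subset hq'
    have hb := hG.star_skip (projSet_subset hq) hq₁ hqb
    have e : G.ι s * p * (G.ι a * r * star (G.ι b)) * (q * star (G.ι t)) =
        G.ι z * (p' * r * q') * star (G.ι z) := by
      calc G.ι s * p * (G.ι a * r * star (G.ι b)) * (q * star (G.ι t))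
          = G.ι s * (p * G.ι a) * r * (star (G.ι b) * q) * star (G.ι t) := by
            simp only [mul_assoc]
        _ = G.ι s * G.ι a * (p' * r * q') * star (G.ι t * G.ι b) := by
            rw [hpa, hb, star_mul]; simp only [mul_assoc]
        _ = _ := by rw [h₁, h₂]
    rw [e]
    refine AddSubmonoid.subset_closure ⟨z, a, b, p' * r * q',
      hG.mul_mem_left (hG.mul_mem_left hp' hr) hq₁, h₁, h₂, rfl, ?_, ?_⟩ <;> rw [mul_assoc]
    · rw [hG.star_ι_mul_diag hp hp₁ h₁ hpa, mul_assoc, ← mul_assoc _ p',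
        hG.comm (hG.mul_mem₁ (hG.mul_mem₁ hp₁ hr) hq₁) hp₁, ← mul_assoc p', ← mul_assoc p',
        hG.mul_self hp₁, ← mul_assoc]
    · rw [hG.star_ι_mul_diag hq hq₁ h₂ hqb, mul_assoc, ← mul_assoc _ q', mul_assoc _ q' q',
        hG.mul_self hq₁, ← mul_assoc]

theorem diagProj_mul_self (hG : G.IsSemigraphAlgebra)
    {E : Unitization ℂ X} (hE : E ∈ G.diagProj) : E * E = E := by
  obtain ⟨s, p, hp, rfl⟩ := hE
  have h := hG.diag_mul_ι hp (isProd_one_right s) (p' := p) (by simp [ι])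
  calc _ = G.ι s * p * star (G.ι s) * G.ι s * p * star (G.ι s) := by simp only [mul_assoc]
    _ = _ := by rw [h, mul_assoc _ p p, hG.mul_self (projSet_subset hp)]

/-- The product `E F` is a sum of self-adjoint elements, so `E F = (E F)* = F E`. -/
theorem diagProj_commute (hG : G.IsSemigraphAlgebra)
    {E F : Unitization ℂ X} (hE : E ∈ G.diagProj) (hF : F ∈ G.diagProj) :
    Commute E F := by
  obtain ⟨s, p, hp, rfl⟩ := hE
  obtain ⟨t, q, hq, rfl⟩ := hF
  have h := hG.diag_mul_diag_mem (s := s) (t := t) hp hq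
  have key : ∀ w ∈ AddSubmonoid.closure {g | ∃ z u v, ∃ r ∈ G.projSet, G.IsProd s u z ∧
      G.IsProd t v z ∧ g = G.ι z * r * star (G.ι z) ∧ g * (G.ι s * p * star (G.ι s)) = g ∧
        g * (G.ι t * q * star (G.ι t)) = g}, star w = w := by
    intro w hw
    induction hw using AddSubmonoid.closure_induction with
    | zero => exact star_zero _
    | add a b _ _ ha hb => rw [star_add, ha, hb]
    | mem g hg =>
      obtain ⟨z, -, -, r, hr, -, -, rfl, -⟩ := hg
      exact hG.star_diag hr
  have := key _ h
  rw [star_mul, hG.star_diag hp, hG.star_diag hq] at this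
  exact this.symm

theorem prod_commute (hG : G.IsSemigraphAlgebra)
    {E : Unitization ℂ X} (hE : E ∈ G.diagProj) {l : List (Unitization ℂ X)}
    (hl : ∀ F ∈ l, F ∈ G.diagProj) : Commute E (l.map (1 - ·)).prod := by
  refine Commute.list_prod_right _ _ fun x hx => ?_
  obtain ⟨F, hF, rfl⟩ := List.mem_map.1 hx
  exact (Commute.one_right E).sub_right (hG.diagProj_commute hE (hl F hF))

theorem prod_mul_self (hG : G.IsSemigraphAlgebra)
    {l : List (Unitization ℂ X)} (hl : ∀ F ∈ l, F ∈ G.diagProj) :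
    (l.map (1 - ·)).prod * (l.map (1 - ·)).prod = (l.map (1 - ·)).prod := by
  induction l with
  | nil => simp
  | cons E l ih =>
    have hE := hl E (by simp)
    have hl' : ∀ F ∈ l, F ∈ G.diagProj := fun F hF => hl F (by simp [hF])
    have hc : Commute (1 - E) (l.map (1 - ·)).prod :=
      (Commute.one_left _).sub_left (hG.prod_commute hE hl')
    rw [List.map_cons, List.prod_cons]
    exact IsIdempotentElem.mul_of_commute hc
      (IsIdempotentElem.one_sub (hG.diagProj_mul_self hE)) (ih hl')

theorem stdAt_commute (hG : G.IsSemigraphAlgebra)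
    {s : G.T₁} {f E : Unitization ℂ X} (hf : f ∈ G.stdAt s)
    (hE : E ∈ G.diagProj) : Commute f E := by
  obtain ⟨p, hp, l, hl, rfl⟩ := hf
  exact ((hG.diagProj_commute ⟨s, p, hp, rfl⟩ hE).symm.mul_right (hG.prod_commute hE hl)).symm

theorem stdAt_mul_self (hG : G.IsSemigraphAlgebra)
    {s : G.T₁} {f : Unitization ℂ X} (hf : f ∈ G.stdAt s) : f * f = f := by
  obtain ⟨p, hp, l, hl, rfl⟩ := hf
  have hE : G.ι s * p * star (G.ι s) ∈ G.diagProj := ⟨s, p, hp, rfl⟩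
  exact IsIdempotentElem.mul_of_commute (hG.prod_commute hE hl) (hG.diagProj_mul_self hE)
    (hG.prod_mul_self hl)

theorem stdAt_mul_ι_mul_star (hG : G.IsSemigraphAlgebra)
    {s : G.T₁} {f : Unitization ℂ X} (hf : f ∈ G.stdAt s) :
    f * G.ι s * star (G.ι s) = f := by
  obtain ⟨p, hp, l, hl, rfl⟩ := hf
  have hE : G.ι s * p * star (G.ι s) ∈ G.diagProj := ⟨s, p, hp, rfl⟩
  rw [(hG.prod_commute hE hl).eq]
  simp only [mul_assoc]
  rw [← mul_assoc (star (G.ι s)), hG.star_mul_ι_mul_star]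

theorem stdAt_mul_one_sub
    {s : G.T₁} {f E : Unitization ℂ X} (hf : f ∈ G.stdAt s)
    (hE : E ∈ G.diagProj) : f * (1 - E) ∈ G.stdAt s := by
  obtain ⟨p, hp, l, hl, rfl⟩ := hf
  refine ⟨p, hp, l ++ [E], ?_, by simp [mul_assoc]⟩
  intro F hF
  rcases List.mem_append.1 hF with h | h
  · exact hl F h
  · rwa [List.mem_singleton.1 h]

theorem refines_refl (hG : G.IsSemigraphAlgebra)
    {s : G.T₁} {f : Unitization ℂ X} (hf : f ∈ G.stdAt s) :
    G.Refines s f s f := ⟨hf, hG.stdAt_mul_self hf, none, isProd_one_right s⟩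

/-- If `u v` were zero, then `z = x u v` would vanish; so `u v` is defined. -/
theorem isProd_trans (hG : G.IsSemigraphAlgebra)
    {x y z u v : G.T₁} (h₁ : G.IsProd x u y) (h₂ : G.IsProd y v z) :
    ∃ w, G.IsProd x w z := by
  have e : G.ι x * (G.ι u * G.ι v) = G.ι z := by rw [← mul_assoc, h₁, h₂]
  rcases hG.ι_mul_eq_zero_or u v with h | ⟨w, hw⟩
  · rw [h, mul_zero] at e
    exact absurd e.symm (hG.ι_ne_zero z)
  · exact ⟨w, by rwa [hw] at e⟩

theorem refines_trans (hG : G.IsSemigraphAlgebra)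
    {x y z : G.T₁} {f g h : Unitization ℂ X} (h₁ : G.Refines z h y g)
    (h₂ : G.Refines y g x f) : G.Refines z h x f := by
  obtain ⟨hh, hg, u, hu⟩ := h₁
  obtain ⟨-, hf, v, hv⟩ := h₂
  exact ⟨hh, by rw [← hg, mul_assoc, hf], hG.isProd_trans hv hu⟩

/-- A standard projection is split by a range projection `E` into a standard projection orthogonal
to `E` and a sum of standard projections below `E`. -/
theorem exists_refines_split (hG : G.IsSemigraphAlgebra)
    {s t : G.T₁} {f q A : Unitization ℂ X} (hf : f ∈ G.stdAt s)
    (hq : q ∈ G.projSet) (hA : f * A ≠ 0) :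
    ∃ z g, G.Refines z g s f ∧ g * A ≠ 0 ∧ (g * (G.ι t * q * star (G.ι t)) = 0 ∨
      g * (G.ι t * q * star (G.ι t)) = g ∧ ∃ v, G.IsProd t v z) := by
  have hE : G.ι t * q * star (G.ι t) ∈ G.diagProj := ⟨t, q, hq, rfl⟩
  -- With `E = t q t*`, split `f A = f (1 - E) A + f E A`. Without a suitable refinement both
  -- summands vanish.
  by_contra! hcon
  have h₁ : f * (1 - G.ι t * q * star (G.ι t)) * A = 0 := by
    by_contra h
    refine (hcon s _ ⟨stdAt_mul_one_sub hf hE, ?_, none, isProd_one_right s⟩ h).1 ?_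
    · have hc : Commute f (1 - G.ι t * q * star (G.ι t)) :=
        (Commute.one_right f).sub_right (hG.stdAt_commute hf hE)
      rw [hc.eq, mul_assoc, hG.stdAt_mul_self hf]
    · rw [mul_assoc, sub_mul, one_mul, hG.diagProj_mul_self hE, sub_self, mul_zero]
  -- The product of the leading factor of `f` with `E` is a sum of range projections below both.
  -- Each, multiplied by the remaining factors of `f`, is a refinement below `E`.
  have h₂ : f * (G.ι t * q * star (G.ι t)) * A = 0 := by
    obtain ⟨p, hp, l, hl, rfl⟩ := id hf
    have hm := hG.diag_mul_diag_mem (s := s) (t := t) hp hq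
    rw [mul_assoc (G.ι s * p * star (G.ι s)), ← (hG.prod_commute hE hl).eq, ← mul_assoc]
    generalize G.ι s * p * star (G.ι s) * (G.ι t * q * star (G.ι t)) = w at hm
    induction hm using AddSubmonoid.closure_induction with
    | zero => simp
    | add a b _ _ ha hb => rw [add_mul, add_mul, ha, hb, add_zero]
    | mem g hg =>
      obtain ⟨z, u, v, r, hr, hu, hv, rfl, hgs, hgt⟩ := hg
      have hF : G.ι z * r * star (G.ι z) ∈ G.diagProj := ⟨z, r, hr, rfl⟩
      generalize hFF : G.ι z * r * star (G.ι z) = F at *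
      by_contra hne
      refine (hcon z (F * (l.map (1 - ·)).prod) ⟨⟨r, hr, l, hl, by rw [hFF]⟩, ?_, u, hu⟩ hne).2
        ?_ v hv
      · have hS : G.ι s * p * star (G.ι s) ∈ G.diagProj := ⟨s, p, hp, rfl⟩
        rw [mul_assoc, ← mul_assoc _ (G.ι s * p * star (G.ι s)), ← (hG.prod_commute hS hl).eq,
          mul_assoc _ _ (List.prod _), hG.prod_mul_self hl, ← mul_assoc, hgs]
      · rw [mul_assoc, ← (hG.prod_commute hE hl).eq, ← mul_assoc, hgt]
  apply hA
  rw [mul_sub, sub_mul, h₂, sub_zero, mul_one] at h₁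
  exact h₁

/-- A standard projection can be refined so that an element of the diagonal acts as a scalar. -/
theorem exists_refines_smul (hG : G.IsSemigraphAlgebra)
    {D : Unitization ℂ X} (hD : D ∈ Submodule.span ℂ G.diagProj) :
    ∀ (s : G.T₁) (f A : Unitization ℂ X), f ∈ G.stdAt s → f * A ≠ 0 →
      ∃ z g, G.Refines z g s f ∧ g * A ≠ 0 ∧ ∃ c : ℂ, g * D = c • g := by
  induction hD using Submodule.span_induction with
  | zero => exact fun s f A hf hA => ⟨s, f, hG.refines_refl hf, hA, 0, by simp⟩
  | smul c D _ ih =>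
    intro s f A hf hA
    obtain ⟨z, g, hg, hgA, c', h⟩ := ih s f A hf hA
    exact ⟨z, g, hg, hgA, c * c', by rw [mul_smul_comm, h, smul_smul]⟩
  | add D₁ D₂ _ _ ih₁ ih₂ =>
    intro s f A hf hA
    obtain ⟨y, g, hg, hgA, c₁, h₁⟩ := ih₁ s f A hf hA
    obtain ⟨z, h, hh, hhA, c₂, h₂⟩ := ih₂ y g A hg.1 hgA
    refine ⟨z, h, hG.refines_trans hh hg, hhA, c₁ + c₂, ?_⟩
    -- The scalar found for `D₁` survives refinement, because `h = h g`.
    have : h * D₁ = c₁ • h := by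
      rw [← hh.2.1, mul_assoc, h₁, mul_smul_comm]
    rw [mul_add, this, h₂, add_smul]
  | mem E hE =>
    obtain ⟨t, q, hq, rfl⟩ := hE
    intro s f A hf hA
    obtain ⟨z, g, hg, hgA, h | h⟩ := hG.exists_refines_split (t := t) hf hq hA
    · exact ⟨z, g, hg, hgA, 0, by rw [h, zero_smul]⟩
    · exact ⟨z, g, hg, hgA, 1, by rw [h.1, one_smul]⟩

end IsSemigraphAlgebra

/-! ### Grading by degree, and passage between `X` and its unitization -/

/-- The degree of an element of `T₁` as an element of `ℤ^k`. -/
noncomputable def intDeg (G : SemigraphData k X) (x : G.T₁) : k →₀ ℤ :=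
  (G.deg₁ x).mapRange (fun n : ℕ => (n : ℤ)) rfl

/-- The linear span of the standard words `a p b*` of degree `n`. -/
def fiber (G : SemigraphData k X) (n : k →₀ ℤ) : Submodule ℂ (Unitization ℂ X) :=
  Submodule.span ℂ {g | ∃ a b, ∃ p ∈ G.projSet, G.intDeg a - G.intDeg b = n ∧
    g = G.ι a * p * star (G.ι b)}

/-- The linear span of the elements `f s q t*` with `d(t) = d(s)`. -/
def rowSpan (G : SemigraphData k X) (f : Unitization ℂ X) (s : G.T₁) :
    Submodule ℂ (Unitization ℂ X) :=
  Submodule.span ℂ {g | ∃ t, G.deg₁ t = G.deg₁ s ∧ ∃ q ∈ G.projSet,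
    g = f * G.ι s * q * star (G.ι t)}

theorem intDeg_injective {x y : G.T₁} (h : G.intDeg x = G.intDeg y) : G.deg₁ x = G.deg₁ y :=
  Finsupp.mapRange_injective _ rfl Nat.cast_injective h

theorem exists_inr_mul_mul (U : Unitization ℂ X) (x : X) (V : Unitization ℂ X) :
    ∃ y : X, (Unitization.inr y : Unitization ℂ X) = U * Unitization.inr x * V :=
  ⟨(U * Unitization.inr x * V).snd, Unitization.ext (by simp) (by simp)⟩

/-- The kernel of `π` absorbs multiplication by elements of the unitization, since `π` extends to an
algebra homomorphism of unitizations. -/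
theorem map_eq_zero_of_inr_eq {B : Type*} [NonUnitalCStarAlgebra B] (π : X →⋆ₙₐ[ℂ] B) {a b : X}
    {U V : Unitization ℂ X} (h : (Unitization.inr b : Unitization ℂ X) = U * Unitization.inr a * V)
    (ha : π a = 0) : π b = 0 := by
  let Φ : Unitization ℂ X →ₐ[ℂ] Unitization ℂ B := Unitization.lift
    ((Unitization.inrNonUnitalAlgHom ℂ B).comp π.toNonUnitalAlgHom)
  have hΦ : ∀ x : X, Φ (Unitization.inr x) = Unitization.inr (π x) := fun x => by
    simp [Φ]
  have := congrArg Φ h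
  rw [map_mul, map_mul, hΦ, hΦ, ha, Unitization.inr_zero, mul_zero, zero_mul] at this
  exact Unitization.inr_injective (R := ℂ) (by simpa using this)

theorem mem_projectionSet {Z : Set X} {x e : X} (hx : x ∈ Z) (l : List (Unitization ℂ X))
    (hl : ∀ E ∈ l, ∃ y ∈ Z, (Unitization.inr (y * star y) : Unitization ℂ X) = E)
    (he : (Unitization.inr e : Unitization ℂ X) =
      Unitization.inr (x * star x) * (l.map (1 - ·)).prod) : e ∈ projectionSet Z := by
  let F : Z → Unitization ℂ X := fun y => Unitization.inr ((y : X) * star (y : X))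
  have hl' : l ∈ Set.range (List.map F) := by
    rw [Set.range_list_map]
    intro E hE
    obtain ⟨y, hy, h⟩ := hl E hE
    exact ⟨⟨y, hy⟩, h⟩
  obtain ⟨l', rfl⟩ := hl'
  refine ⟨x, hx, l'.map Subtype.val, ?_, ?_⟩
  · intro y hy
    obtain ⟨z, -, rfl⟩ := List.mem_map.1 hy
    exact z.2
  · rw [he, List.map_map, List.map_map]
    rfl

namespace IsSemigraphAlgebra

theorem intDeg_of_isProd (hG : G.IsSemigraphAlgebra) {x y z : G.T₁} (h : G.IsProd x y z) :
    G.intDeg z = G.intDeg x + G.intDeg y := by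
  rw [intDeg, hG.deg_mul x y z h]
  exact Finsupp.mapRange_add (fun m n => Nat.cast_add m n) _ _

/-- In `a p b* c q d*`, expand `b* c` into terms `u r v*` and move `p` and `q` inwards. Since `b u =
c v`, one has `d(u) - d(v) = d(c) - d(b)`, so degrees add. -/
theorem mul_mem_fiber (hG : G.IsSemigraphAlgebra)
    {m n : k →₀ ℤ} {x y : Unitization ℂ X} (hx : x ∈ G.fiber m)
    (hy : y ∈ G.fiber n) : x * y ∈ G.fiber (m + n) := by
  have := Submodule.mul_mem_mul hx hy
  rw [fiber, fiber, Submodule.span_mul_span] at this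
  refine Submodule.span_le.2 ?_ this
  rintro _ ⟨_, ⟨a, b, p, hp, rfl, rfl⟩, _, ⟨c, d, q, hq, rfl, rfl⟩, rfl⟩
  have h := hG.star_ι_mul_ι_mem b c
  have e : G.ι a * p * star (G.ι b) * (G.ι c * q * star (G.ι d)) =
      G.ι a * p * (star (G.ι b) * G.ι c) * (q * star (G.ι d)) := by simp only [mul_assoc]
  change G.ι a * p * star (G.ι b) * (G.ι c * q * star (G.ι d)) ∈ G.fiber _
  rw [e]
  generalize star (G.ι b) * G.ι c = w at h
  induction h using AddSubmonoid.closure_induction with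
  | zero => simp
  | add _ _ _ _ ha hb => rw [mul_add, add_mul]; exact add_mem ha hb
  | mem g hg =>
    obtain ⟨u, v, z, r, h₁, h₂, -, hr, rfl⟩ := hg
    obtain ⟨p', hp', hpu⟩ := hG.exists_skip hp u
    obtain ⟨q', hq', hqv⟩ := hG.exists_skip hq v
    have hv := hG.star_skip (projSet_subset hq) (projSet_subset hq') hqv
    have e : G.ι a * p * (G.ι u * r * star (G.ι v)) * (q * star (G.ι d)) =
        G.ι a * G.ι u * (p' * r * q') * star (G.ι d * G.ι v) := by
      calc _ = G.ι a * (p * G.ι u) * r * (star (G.ι v) * q) * star (G.ι d) := by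
            simp only [mul_assoc]
        _ = _ := by rw [hpu, hv, star_mul]; simp only [mul_assoc]
    rw [e]
    rcases hG.ι_mul_eq_zero_or a u with h₀ | ⟨x, hx⟩
    · simp [h₀]
    rcases hG.ι_mul_eq_zero_or d v with h₀ | ⟨y, hy⟩
    · simp [h₀]
    refine Submodule.subset_span ⟨x, y, p' * r * q',
      hG.mul_mem_left (hG.mul_mem_left hp' hr) (projSet_subset hq'), ?_, by rw [hx, hy]⟩
    have hz := (hG.intDeg_of_isProd h₁).symm.trans (hG.intDeg_of_isProd h₂)
    rw [hG.intDeg_of_isProd hx, hG.intDeg_of_isProd hy, eq_sub_of_add_eq' hz]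
    abel

/-- The middle factor must come from `P` and not be the unit; for `t` and `t*` the source projection
serves, as `t = t (t* t)`. -/
theorem evalLetter_mem_fiber (hG : G.IsSemigraphAlgebra) (l : G.Letter) :
    (Unitization.inr (G.evalLetter l) : Unitization ℂ X) ∈ G.fiber (G.letterDegree l) := by
  have h₀ : G.intDeg none = 0 := Finsupp.mapRange_zero
  rcases l with ⟨p | t, _ | _⟩
  · exact Submodule.subset_span ⟨none, none, _, ⟨p, p.2, rfl⟩, sub_self _, by
      simp [ι, evalLetter]⟩
  · refine Submodule.subset_span ⟨none, none, _, ⟨p, p.2, rfl⟩, sub_self _, ?_⟩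
    simp [ι, evalLetter, (hG.proj p p.2).isSelfAdjoint.star_eq]
  · refine Submodule.subset_span ⟨some t, none, _, hG.star_ι_mul_ι_self_mem t, ?_, ?_⟩
    · rw [h₀, sub_zero]; rfl
    · rw [← mul_assoc, hG.ι_mul_star_mul]; simp [ι, evalLetter]
  · refine Submodule.subset_span ⟨none, some t, _, hG.star_ι_mul_ι_self_mem t, ?_, ?_⟩
    · rw [h₀, zero_sub]; rfl
    · rw [mul_assoc, hG.star_mul_ι_mul_star]; simp [ι, evalLetter]

theorem evalWord_mem_fiber (hG : G.IsSemigraphAlgebra) (w : G.Word) :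
    (Unitization.inr (G.evalWord w) : Unitization ℂ X) ∈ G.fiber (G.wordDegree w) := by
  induction w using FreeSemigroup.recOnMul with
  | ih1 l => simpa [evalWord, wordDegree] using hG.evalLetter_mem_fiber l
  | ih2 l w h₁ h₂ =>
    have := hG.mul_mem_fiber h₁ h₂
    simpa [wordDegree] using this

theorem inr_mem_fiber_of_mem_core (hG : G.IsSemigraphAlgebra) {x : X} (hx : x ∈ G.core) :
    (Unitization.inr x : Unitization ℂ X) ∈ G.fiber 0 := by
  have : G.core ≤ (G.fiber 0).comap (Unitization.inrHom ℂ ℂ X) := by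
    refine Submodule.span_le.2 ?_
    rintro _ ⟨w, hw, rfl⟩
    have := hG.evalWord_mem_fiber w
    rwa [hw] at this
  exact this hx

/-! ### Compression of a core element to a row -/

/-- Each word `a p b*` is killed by `1 - a p a*`, so a finite product of factors `1 - E` kills `x`.
If every `E x` were zero, this product would also fix `x`. -/
theorem exists_diagProj_mul_ne_zero (hG : G.IsSemigraphAlgebra)
    {n : k →₀ ℤ} {x : Unitization ℂ X} (hx : x ∈ G.fiber n)
    (h₀ : x ≠ 0) : ∃ E ∈ G.diagProj, E * x ≠ 0 := by
  by_contra! hcon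
  obtain ⟨l, hl, h⟩ : ∃ l : List (Unitization ℂ X), (∀ E ∈ l, E ∈ G.diagProj) ∧
      (l.map (1 - ·)).prod * x = 0 := by
    clear hcon h₀
    induction hx using Submodule.span_induction with
    | zero => exact ⟨[], by simp, by simp⟩
    | smul c x _ ih =>
      obtain ⟨l, hl, h⟩ := ih
      exact ⟨l, hl, by rw [mul_smul_comm, h, smul_zero]⟩
    | add x y _ _ ihx ihy =>
      obtain ⟨l, hl, hx⟩ := ihx
      obtain ⟨l', hl', hy⟩ := ihy
      have hc : Commute (l.map (1 - ·)).prod (l'.map (1 - ·)).prod := by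
        refine (Commute.list_prod_right _ _ fun y hy => ?_)
        obtain ⟨F, hF, rfl⟩ := List.mem_map.1 hy
        exact (Commute.one_right _).sub_right (hG.prod_commute (hl' F hF) hl).symm
      refine ⟨l ++ l', fun E hE => (List.mem_append.1 hE).elim (hl E) (hl' E), ?_⟩
      rw [List.map_append, List.prod_append, mul_add, mul_assoc _ _ y, hy, hc.eq, mul_assoc, hx]
      simp
    | mem g hg =>
      obtain ⟨a, b, p, hp, -, rfl⟩ := hg
      refine ⟨[G.ι a * p * star (G.ι a)], ?_, ?_⟩
      · intro E hE
        rw [List.mem_singleton.1 hE]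
        exact ⟨a, p, hp, rfl⟩
      · have h := hG.diag_mul_ι hp (isProd_one_right a) (p' := p) (by simp [ι])
        have : G.ι a * p * star (G.ι a) * (G.ι a * p * star (G.ι b)) =
            G.ι a * p * star (G.ι b) := by
          rw [← mul_assoc, ← mul_assoc, h, mul_assoc _ p p, hG.mul_self (projSet_subset hp)]
        simp only [List.map_cons, List.map_nil, List.prod_cons, List.prod_nil, mul_one, sub_mul,
          one_mul, this, sub_self]
  refine h₀ ?_
  rw [← h]
  clear h
  induction l with
  | nil => simp
  | cons E l ih =>
    rw [List.map_cons, List.prod_cons, mul_assoc, ← ih fun F hF => hl F (by simp [hF]), sub_mul,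
      one_mul, hcon E (hl E (by simp)), sub_zero]

/-- Insert `f = f z z*` with `z = a u` and move `a* a p` past `u*`: the word becomes `f z q (b u)*`.
Equality of `d(a)` and `d(b)` gives `d(b u) = d(z)`. -/
theorem stdAt_mul_word_mem_rowSpan (hG : G.IsSemigraphAlgebra)
    {a b u z : G.T₁} {f p : Unitization ℂ X} (hf : f ∈ G.stdAt z)
    (hz : G.IsProd a u z) (hd : G.deg₁ a = G.deg₁ b) (hp : p ∈ G.projSet) :
    f * (G.ι a * p * star (G.ι b)) ∈ G.rowSpan f z := by
  have hp₁ := hG.mul_mem_right (hG.star_ι_mul_ι_self_mem₁ a) hp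
  obtain ⟨q, hq, h⟩ := hG.exists_skip hp₁ u
  have h' := hG.star_skip (projSet_subset hp₁) (projSet_subset hq) h
  have e : f * (G.ι a * p * star (G.ι b)) = f * G.ι z * q * star (G.ι b * G.ι u) := by
    calc f * (G.ι a * p * star (G.ι b))
        = f * G.ι z * star (G.ι z) * (G.ι a * p * star (G.ι b)) := by
          rw [hG.stdAt_mul_ι_mul_star hf]
      _ = f * G.ι z * (star (G.ι u) * (star (G.ι a) * G.ι a * p)) * star (G.ι b) := by
          nth_rewrite 2 [← hz]
          rw [star_mul]; simp only [mul_assoc]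
      _ = _ := by rw [h', star_mul]; simp only [mul_assoc]
  rw [e]
  rcases hG.ι_mul_eq_zero_or b u with h₀ | ⟨t, ht⟩
  · simp [h₀]
  · exact Submodule.subset_span ⟨t, by
      rw [hG.deg_mul b u t ht, hG.deg_mul a u z hz, hd], q, hq, by rw [ht]⟩

/-- A standard projection can be refined so that it compresses an element of the core to a row. -/
theorem exists_refines_rowSpan (hG : G.IsSemigraphAlgebra)
    {x : Unitization ℂ X} (hx : x ∈ G.fiber 0) :
    ∀ (s : G.T₁) (f A : Unitization ℂ X), f ∈ G.stdAt s → f * A ≠ 0 →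
      ∃ z g, G.Refines z g s f ∧ g * A ≠ 0 ∧
        ∀ z' g', G.Refines z' g' z g → g' * x ∈ G.rowSpan g' z' := by
  induction hx using Submodule.span_induction with
  | zero => exact fun s f A hf hA => ⟨s, f, hG.refines_refl hf, hA, by simp⟩
  | smul c x _ ih =>
    intro s f A hf hA
    obtain ⟨z, g, hg, hgA, h⟩ := ih s f A hf hA
    refine ⟨z, g, hg, hgA, fun z' g' hr => ?_⟩
    rw [mul_smul_comm]
    exact Submodule.smul_mem _ _ (h z' g' hr)
  | add x y _ _ ihx ihy =>
    intro s f A hf hA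
    obtain ⟨z, g, hg, hgA, h₁⟩ := ihx s f A hf hA
    obtain ⟨w, h, hh, hhA, h₂⟩ := ihy z g A hg.1 hgA
    -- The row condition for `x` was required of all later refinements, so it persists after
    -- refining for `y`.
    refine ⟨w, h, hG.refines_trans hh hg, hhA, fun z' g' hr => ?_⟩
    rw [mul_add]
    exact add_mem (h₁ z' g' (hG.refines_trans hr hh)) (h₂ z' g' hr)
  | mem g hg =>
    obtain ⟨a, b, p, hp, hd, rfl⟩ := hg
    have hd' := intDeg_injective (sub_eq_zero.1 hd)
    intro s f A hf hA
    obtain ⟨z, g, hg, hgA, h | ⟨-, v, hv⟩⟩ := hG.exists_refines_split (t := a) hf hp hA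
    -- Here `g` is orthogonal to `a p a*`, so every refinement of `g` kills the word.
    · refine ⟨z, g, hg, hgA, fun z' g' hr => ?_⟩
      have hw : G.ι a * p * star (G.ι b) =
          G.ι a * p * star (G.ι a) * (G.ι a * p * star (G.ι b)) := by
        rw [← mul_assoc, ← mul_assoc, hG.diag_mul_ι hp (isProd_one_right a) (p' := p)
          (by simp [ι]), mul_assoc _ p p, hG.mul_self (projSet_subset hp)]
      rw [hw, ← hr.2.1, mul_assoc g' g, ← mul_assoc g, h]
      simp
    · refine ⟨z, g, hg, hgA, fun z' g' hr => ?_⟩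
      obtain ⟨u, hu⟩ := hr.2.2
      obtain ⟨w, hw⟩ := hG.isProd_trans hv hu
      exact hG.stdAt_mul_word_mem_rowSpan hr.1 hw hd' hp

theorem exists_mul_ι_ne_zero (hG : G.IsSemigraphAlgebra)
    {f y : Unitization ℂ X} {s : G.T₁} (hy : y ∈ G.rowSpan f s)
    (h₀ : y ≠ 0) : ∃ t, G.deg₁ t = G.deg₁ s ∧ y * G.ι t ≠ 0 := by
  classical
  by_contra! hcon
  -- The projections `t t*` for the finitely many `t` in the row reproduce `y` from the right.
  -- Allowing every larger `N` lets the sets of two summands be united.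
  obtain ⟨M, hM, h⟩ : ∃ M : Finset G.T₁, (∀ t ∈ M, G.deg₁ t = G.deg₁ s) ∧
      ∀ N : Finset G.T₁, (∀ t ∈ N, G.deg₁ t = G.deg₁ s) → M ⊆ N →
        y = ∑ t ∈ N, y * G.ι t * star (G.ι t) := by
    clear hcon h₀
    induction hy using Submodule.span_induction with
    | zero => exact ⟨∅, by simp, by simp⟩
    | smul c x _ ih =>
      obtain ⟨M, hM, h⟩ := ih
      refine ⟨M, hM, fun N hN hMN => ?_⟩
      conv_lhs => rw [h N hN hMN]
      simp only [Finset.smul_sum, smul_mul_assoc]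
    | add x y _ _ ihx ihy =>
      obtain ⟨M, hM, hx⟩ := ihx
      obtain ⟨M', hM', hy⟩ := ihy
      refine ⟨M ∪ M', fun t ht => (Finset.mem_union.1 ht).elim (hM t) (hM' t),
        fun N hN hMN => ?_⟩
      conv_lhs => rw [hx N hN (Finset.union_subset_left hMN),
        hy N hN (Finset.union_subset_right hMN)]
      simp only [← Finset.sum_add_distrib, add_mul]
    | mem g hg =>
      obtain ⟨t, ht, q, hq, rfl⟩ := hg
      refine ⟨{t}, by simpa using ht, fun N hN hMN => ?_⟩
      have htN : t ∈ N := by simpa using hMN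
      rw [Finset.sum_eq_single_of_mem t htN]
      · rw [mul_assoc (f * G.ι s * q), mul_assoc (f * G.ι s * q), hG.star_mul_ι_mul_star]
      · intro u hu hut
        rw [mul_assoc (_ * q), hG.star_ι_mul_ι_eq_zero (ht.trans (hN u hu).symm) (Ne.symm hut)]
        simp
  refine h₀ ?_
  rw [h M hM subset_rfl]
  exact Finset.sum_eq_zero fun t ht => by rw [hcon t (hM t ht), zero_mul]

/-- Right multiplication by `t` removes all terms `f s q u*` with `u ≠ t`; the others yield `D` as a
combination of elements `s q (t* t) s*`. -/
theorem exists_diagonal_of_mem_rowSpan (hG : G.IsSemigraphAlgebra)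
    {f y : Unitization ℂ X} {s t : G.T₁}
    (hy : y ∈ G.rowSpan f s) (ht : G.deg₁ t = G.deg₁ s) :
    ∃ D ∈ Submodule.span ℂ G.diagProj, y * G.ι t = f * D * G.ι s ∧
      y * G.ι t * star (G.ι s) = f * D := by
  induction hy using Submodule.span_induction with
  | zero => exact ⟨0, Submodule.zero_mem _, by simp, by simp⟩
  | smul c x _ ih =>
    obtain ⟨D, hD, h₁, h₂⟩ := ih
    exact ⟨c • D, Submodule.smul_mem _ _ hD, by simp [h₁], by simp [h₂]⟩
  | add x y _ _ ihx ihy =>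
    obtain ⟨D, hD, h₁, h₂⟩ := ihx
    obtain ⟨D', hD', h₁', h₂'⟩ := ihy
    exact ⟨D + D', add_mem hD hD', by simp only [add_mul, mul_add, h₁, h₁'],
      by simp only [add_mul, mul_add, h₂, h₂']⟩
  | mem g hg =>
    obtain ⟨u, hu, q, hq, rfl⟩ := hg
    by_cases hut : u = t
    · subst hut
      have hq' := hG.mul_mem_left hq (hG.star_ι_mul_ι_self_mem₁ u)
      refine ⟨_, Submodule.subset_span ⟨s, _, hq', rfl⟩, ?_, by simp only [mul_assoc]⟩
      rw [mul_assoc f (_ * star (G.ι s)), hG.diag_mul_ι hq' (isProd_one_right s)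
        (p' := q * (star (G.ι u) * G.ι u)) (by simp [ι])]
      simp only [mul_assoc]
    · refine ⟨0, Submodule.zero_mem _, ?_, ?_⟩ <;>
      simp [mul_assoc (f * G.ι s * q), hG.star_ι_mul_ι_eq_zero (hu.trans ht.symm) hut]

/-! ### Fullness and elementary standard projections -/

theorem exists_halfStandardWord (hG : G.IsSemigraphAlgebra)
    {E : Unitization ℂ X} (hE : E ∈ G.diagProj) :
    ∃ y ∈ G.halfStandardWords, (Unitization.inr (y * star y) : Unitization ℂ X) = E := by
  obtain ⟨s, _, ⟨p, hp, rfl⟩, rfl⟩ := hE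
  obtain ⟨y, hy⟩ := exists_inr_mul_mul (G.ι s) p 1
  rw [mul_one] at hy
  refine ⟨y, ⟨s, p, hp, hy⟩, ?_⟩
  have hp' : (Unitization.inr p : Unitization ℂ X) ∈ G.projSet₁ := projSet_subset ⟨p, hp, rfl⟩
  rw [Unitization.inr_mul, Unitization.inr_star, hy, star_mul, hG.star_eq hp', mul_assoc,
    ← mul_assoc (Unitization.inr p), hG.mul_self hp', ← mul_assoc]

theorem exists_standardProjection (hG : G.IsSemigraphAlgebra)
    {s : G.T₁} {f : Unitization ℂ X} (hf : f ∈ G.stdAt s) :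
    ∃ e ∈ G.standardProjections, Unitization.inr e = f := by
  obtain ⟨p, hp, l, hl, rfl⟩ := hf
  obtain ⟨y, hy, h⟩ := hG.exists_halfStandardWord ⟨s, p, hp, rfl⟩
  obtain ⟨e, he⟩ := exists_inr_mul_mul 1 (y * star y) (l.map (1 - ·)).prod
  rw [one_mul] at he
  exact ⟨e, mem_projectionSet hy l (fun E hE => hG.exists_halfStandardWord (hl E hE)) he,
    by rw [he, h]⟩

/-- For `d(y) ≥ d(s)` write `y = a b` with `d(a) = d(s)`. Either `a = s` and `p` moves past `b`, or
`s* a = 0`. -/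
theorem diagProj_mul_ι (hG : G.IsSemigraphAlgebra) {E : Unitization ℂ X} (hE : E ∈ G.diagProj) :
    ∃ N, ∀ y, N ≤ G.deg₁ y → E * G.ι y = 0 ∨ ∃ q ∈ G.projSet, E * G.ι y = G.ι y * q := by
  obtain ⟨s, p, hp, rfl⟩ := hE
  refine ⟨G.deg₁ s, fun y hy => ?_⟩
  obtain ⟨⟨a, b⟩, ⟨hab, ha, -⟩, -⟩ :=
    hG.factorization y (G.deg₁ s) (G.deg₁ y - G.deg₁ s) (add_tsub_cancel_of_le hy).symm
  by_cases h : s = a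
  · subst h
    obtain ⟨q, hq, hpq⟩ := hG.exists_skip hp b
    exact .inr ⟨q, hq, hG.diag_mul_ι hp hab hpq⟩
  · left
    have hab' : G.ι a * G.ι b = G.ι y := hab
    rw [← hab', mul_assoc, ← mul_assoc (star (G.ι s)), hG.star_ι_mul_ι_eq_zero ha.symm h]
    simp

theorem prod_mul_ι (hG : G.IsSemigraphAlgebra)
    {l : List (Unitization ℂ X)} (hl : ∀ E ∈ l, E ∈ G.diagProj) :
    ∃ N, ∀ y, N ≤ G.deg₁ y → ∃ l' : List (Unitization ℂ X), (∀ q ∈ l', q ∈ G.projSet) ∧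
      (l.map (1 - ·)).prod * G.ι y = G.ι y * (l'.map (1 - ·)).prod := by
  induction l with
  | nil => exact ⟨0, fun y _ => ⟨[], by simp, by simp⟩⟩
  | cons E l ih =>
    obtain ⟨N, hN⟩ := ih fun F hF => hl F (by simp [hF])
    obtain ⟨N', hN'⟩ := hG.diagProj_mul_ι (hl E (by simp))
    refine ⟨N ⊔ N', fun y hy => ?_⟩
    obtain ⟨l', hl', h⟩ := hN y (le_sup_left.trans hy)
    rcases hN' y (le_sup_right.trans hy) with h₀ | ⟨q, hq, hE⟩
    · refine ⟨l', hl', ?_⟩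
      rw [List.map_cons, List.prod_cons, mul_assoc, h, ← mul_assoc, sub_mul, one_mul, h₀, sub_zero]
    · refine ⟨q :: l', ?_, ?_⟩
      · intro r hr
        rcases List.mem_cons.1 hr with rfl | hr
        exacts [hq, hl' r hr]
      · rw [List.map_cons, List.prod_cons, mul_assoc, h, ← mul_assoc, sub_mul, one_mul, hE,
          List.map_cons, List.prod_cons, ← mul_assoc, mul_sub, mul_one]

/-- In a full semigraph algebra every nonzero standard projection compresses to a nonzero
elementary standard projection. -/
theorem exists_elementary (hG : G.IsSemigraphAlgebra)
    (hfull : G.IsFull) {s : G.T₁} {f : Unitization ℂ X}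
    (hf : f ∈ G.stdAt s) (h₀ : f ≠ 0) :
    ∃ y, ∃ e ∈ G.elementaryStandardProjections, e ≠ 0 ∧
      Unitization.inr e = star (G.ι y) * f * G.ι y := by
  obtain ⟨e, he, hef⟩ := hG.exists_standardProjection hf
  have hv : e ∉ G.vanishing := fun hv => by
    have : e ∈ starIdealSpan (star : X → X) G.vanishing :=
      Submodule.mem_sInf.2 fun I hI => hI.1 hv
    rw [hfull, Submodule.mem_bot] at this
    exact h₀ (by rw [← hef, this, Unitization.inr_zero])
  obtain ⟨x, hx, hfr⟩ : ∃ x, G.IsIncreasing x ∧ ∃ᶠ n in Filter.atTop, f * G.ι (x n) ≠ 0 := by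
    by_contra! hcon
    refine hv ⟨he, fun x hx => ?_⟩
    simpa only [hef] using hcon x hx
  obtain ⟨p, hp, l, hl, rfl⟩ := hf
  obtain ⟨N, hN⟩ := hG.diagProj_mul_ι ⟨s, p, hp, rfl⟩
  obtain ⟨N', hN'⟩ := hG.prod_mul_ι hl
  -- Nonvanishing along a frequent set of indices allows a degree above both thresholds.
  obtain ⟨n, hne, hn⟩ := (hfr.and_eventually (Filter.eventually_ge_atTop (N ⊔ N'))).exists
  rw [← hx.1 n] at hn
  generalize x n = y at *
  obtain ⟨l', hl', hy'⟩ := hN' y (le_sup_right.trans hn)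
  have e₁ : G.ι s * p * star (G.ι s) * (l.map (1 - ·)).prod * G.ι y =
      G.ι s * p * star (G.ι s) * G.ι y * (l'.map (1 - ·)).prod := by
    rw [mul_assoc, hy', ← mul_assoc]
  rcases hN y (le_sup_left.trans hn) with h | ⟨q, hq, hy⟩
  · exact absurd (by rw [e₁, h, zero_mul]) hne
  rw [hy] at e₁
  -- The first factor of `y* f y` is `y* y q`, again an element of `P`.
  have hr := hG.mul_mem_right (hG.star_ι_mul_ι_self_mem₁ y) hq
  have hP : ∀ r ∈ G.projSet, ∃ y ∈ G.P, (Unitization.inr (y * star y) : Unitization ℂ X) = r := by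
    rintro _ ⟨r, hr, rfl⟩
    exact ⟨r, hr, by rw [(hG.proj r hr).isSelfAdjoint.star_eq,
      (hG.proj r hr).isIdempotentElem.eq]⟩
  obtain ⟨r, hrP, hr'⟩ := hP _ hr
  obtain ⟨e', he'⟩ := exists_inr_mul_mul 1 (r * star r) (l'.map (1 - ·)).prod
  rw [one_mul] at he'
  refine ⟨y, e', mem_projectionSet hrP l' (fun E hE => hP E (hl' E hE)) he', ?_, ?_⟩
  -- Multiplying `e'` by `y` from the left recovers `f y`, which is nonzero.
  · rintro rfl
    refine hne ?_
    have := congrArg (G.ι y * ·) he'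
    simp only [Unitization.inr_zero, mul_zero] at this
    rw [e₁, this, hr', ← mul_assoc, ← mul_assoc, ← mul_assoc, hG.ι_mul_star_mul]
  · rw [he', hr', mul_assoc (star (G.ι y)) (_ * List.prod _), e₁]
    simp only [mul_assoc]

theorem elementary_mem_core (hG : G.IsSemigraphAlgebra)
    {e : X} (he : e ∈ G.elementaryStandardProjections) : e ∈ G.core := by
  have hP : Submodule.span ℂ G.P ≤ G.core := by
    refine Submodule.span_mono fun p hp => ?_
    exact ⟨FreeSemigroup.of (Sum.inl ⟨p, hp⟩, false), by simp [wordDegree, letterDegree],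
      by simp [evalWord, evalLetter]⟩
  obtain ⟨p, hp, l, hl, h⟩ := he
  refine hP ?_
  rw [(hG.proj p hp).isSelfAdjoint.star_eq, (hG.proj p hp).isIdempotentElem.eq] at h
  -- The induction needs the span of `P`, since `p (1 - q) = p - p q` may leave `P`.
  have hp' := Submodule.subset_span (R := ℂ) hp
  clear hp
  induction l generalizing p with
  | nil =>
    rw [List.map_nil, List.prod_nil, mul_one] at h
    rwa [Unitization.inr_injective h]
  | cons q l ih =>
    have hq : q ∈ G.P := hl q (by simp)
    refine ih (p - p * q) (fun y hy => hl y (by simp [hy])) ?_ (sub_mem hp' ?_)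
    · rw [h, List.map_cons, List.prod_cons, ← mul_assoc, mul_sub, mul_one, ← Unitization.inr_mul,
        ← Unitization.inr_sub, (hG.proj q hq).isSelfAdjoint.star_eq,
        (hG.proj q hq).isIdempotentElem.eq]
    · clear h
      induction hp' using Submodule.span_induction with
      | zero => simp
      | smul c x _ ih => rw [smul_mul_assoc]; exact Submodule.smul_mem _ _ ih
      | add x y _ _ hx hy => rw [add_mul]; exact add_mem hx hy
      | mem x hx => exact Submodule.subset_span (hG.proj_mul x hx q hq)

/-! ### Conclusion -/

/-- A nonzero element of the core can be multiplied to a nonzero standard projection. -/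
theorem exists_stdAt_eq_mul (hG : G.IsSemigraphAlgebra)
    {x : Unitization ℂ X} (hx : x ∈ G.fiber 0) (h₀ : x ≠ 0) :
    ∃ s, ∃ f ∈ G.stdAt s, f ≠ 0 ∧ ∃ U V, f = U * x * V := by
  obtain ⟨_, ⟨s, p, hp, rfl⟩, hE⟩ := hG.exists_diagProj_mul_ne_zero hx h₀
  obtain ⟨z, g, hg, hgx, hrow⟩ := hG.exists_refines_rowSpan hx s _ x
    ⟨p, hp, [], by simp, by simp⟩ hE
  have hrow' := hrow z g (hG.refines_refl hg.1)
  obtain ⟨t, ht, hne⟩ := hG.exists_mul_ι_ne_zero hrow' hgx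
  obtain ⟨D, hD, h₁, h₂⟩ := hG.exists_diagonal_of_mem_rowSpan hrow' ht
  have hgD : g * D ≠ 0 := fun h => hne (by rw [h₁, h, zero_mul])
  -- Here `D` is also the element kept nonzero, so `c f = f D ≠ 0` and both `c` and `f` are nonzero.
  obtain ⟨w, f, hf, hfD, c, hc⟩ := hG.exists_refines_smul hD z g D hg.1 hgD
  rw [hc] at hfD
  refine ⟨w, f, hf.1, fun h => hfD (by rw [h, smul_zero]), c⁻¹ • f,
    G.ι t * star (G.ι z), ?_⟩
  have hc₀ : c ≠ 0 := fun h => hfD (by rw [h, zero_smul])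
  calc f = c⁻¹ • (f * D) := by rw [hc, inv_smul_smul₀ hc₀]
    _ = c⁻¹ • (f * (g * x * G.ι t * star (G.ι z))) := by rw [h₂, ← mul_assoc, hf.2.1]
    _ = c⁻¹ • (f * g * x * G.ι t * star (G.ι z)) := by simp only [mul_assoc]
    _ = _ := by rw [hf.2.1]; simp only [smul_mul_assoc, mul_assoc]

end IsSemigraphAlgebra

end SemigraphData

theorem lemma9p6 {k X B : Type*} [NonUnitalRing X] [StarRing X] [Module ℂ X]
    [IsScalarTower ℂ X X] [SMulCommClass ℂ X X] [StarModule ℂ X] [NonUnitalCStarAlgebra B]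
    (G : SemigraphData k X) (hG : G.IsSemigraphAlgebra) (hfull : G.IsFull)
    (π : X →⋆ₙₐ[ℂ] B) :
    Set.InjOn π (G.core : Set X) ↔
      ∀ e ∈ G.elementaryStandardProjections, e ≠ 0 → π e ≠ 0 := by
  constructor
  · intro h e he h₀ hπ
    exact h₀ (h (hG.elementary_mem_core he) (Submodule.zero_mem _) (by rw [hπ, map_zero]))
  · intro h x hx y hy hxy
    by_contra hne
    have h₀ : (Unitization.inr (x - y) : Unitization ℂ X) ≠ 0 := fun h₀ =>
      hne (sub_eq_zero.1 (Unitization.inr_injective (R := ℂ) (by simpa using h₀)))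
    obtain ⟨s, f, hf, hf₀, U, V, hUV⟩ :=
      hG.exists_stdAt_eq_mul (hG.inr_mem_fiber_of_mem_core (G.core.sub_mem hx hy)) h₀
    obtain ⟨t, e, he, he₀, het⟩ := hG.exists_elementary hfull hf hf₀
    -- The projection `e = t* U (x - y) V t` lies in the ideal generated by `x - y`, which `π`
    -- kills.
    refine h e he he₀ (SemigraphData.map_eq_zero_of_inr_eq π (a := x - y)
      (U := star (G.ι t) * U) (V := V * G.ι t) ?_ (by rw [map_sub, hxy, sub_self]))
    rw [het, hUV]
    simp only [mul_assoc]
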